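/- **Theorem (existence of Krasovskii solutions).** Let $n\ge 1$ and let $\mathcal X\subset\mathbb R^n$ be locally compact, i.e. the intersection of an open and a closed set. Let $f:\mathcal X\to\mathbb R^n$ be locally bounded: every $x\in\mathcal X$ has a relative neighborhood in $\mathcal X$ on which $\|f\|$ is bounded. Let $g$ be a metric on $\mathcal X$, i.e. a map assigning to each $x\in\mathcal X$ an inner product $\langle\cdot,\cdot\rangle_{g(x)}$ on $\mathbb R^n$ (no regularity in $x$ is required), with $\|v\|_{g(x)}=\sqrt{\langle v,v\rangle_{g(x)}}$. Put $$\kappa(x)=\frac{\max_{\|v\|=1}\|v\|_{g(x)}}{\min_{\|v\|=1}\|v\|_{g(x)}},$$ and assume that $g$ is locally weakly bounded: for every $x\in\mathcal X$ there are $\ell,M>0$ with $\ell\le\kappa(y)\le M$ for all $y\in\mathcal X$ in a neighborhood of $x$. For $x\in\mathcal X$ let $T_x\mathcal X$ be the tangent (contingent) cone, i.e. the set of all limits $v=\lim_k (x_k-x)/\delta_k$ with $x_k\in\mathcal X$, $x_k\to x$, $\delta_k>0$, $\delta_k\to0$. The projected vector field is the set-valued map $$\Pi f(x)=\Pi_{\mathcal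 X}^g f(x)=\operatorname*{arg\,min}_{v\in T_x\mathcal X}\|v-f(x)\|_{g(x)}^2 ,$$ and its Krasovskii regularization is $$K[\Pi f](x)=\overline{\mathrm{co}}\,\limsup_{y\to x}\Pi f(y),$$ the closed convex hull of the outer limit, where $\limsup_{y\to x}\Pi f(y)$ is the set of all limits of sequences $v_k\in\Pi f(y_k)$ with $y_k\in\mathcal X$, $y_k\to x$. A Krasovskii solution of $\dot x\in\Pi f(x)$, $x(0)=x_0$, on $[0,T)$, $0<T\le\infty$, is a map $x:[0,T)\to\mathcal X$ with $x(0)=x_0$ that is absolutely continuous on compact subintervals and satisfies $\dot x(t)\in K[\Pi f](x(t))$ for almost every $t\in[0,T)$. Then for every $x_0\in\mathcal X$ there are $T\in(0,\infty]$ and a Krasovskii solution $x:[0,T)\to\mathcal X$ of $\dot x\in\Pi f(x)$, $x(0)=x_0$, which is locally Lipschitz on $[0,T)$ and satisfies $$T>\frac rL$$ for all $r>0$ and $L>0$ such that $U_r=\{y\in\mathcal X : \|y-x_0\|\le r\}$ is closed in $\mathbb R^n$ and $\|v\|\le L$ for all $y\in U_r$ and all $v\in K[\Pi f](y)$. -/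

import Mathlib

open Set Filter Topology MeasureTheory

namespace ProjDyn

/-- An inner product on `ℝⁿ`, i.e. a symmetric positive definite bilinear form. -/
structure IsInnerProduct {n : ℕ} (B : LinearMap.BilinForm ℝ (EuclideanSpace ℝ (Fin n))) :
    Prop where
  symm : ∀ u v, B u v = B v u
  nonneg : ∀ u, 0 ≤ B u u
  definite : ∀ u, B u u = 0 ↔ u = 0

/-- The norm `‖v‖_B = √(B(v, v))` induced by an inner product `B`. -/
noncomputable def formNorm {n : ℕ} (B : LinearMap.BilinForm ℝ (EuclideanSpace ℝ (Fin n)))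
    (v : EuclideanSpace ℝ (Fin n)) : ℝ :=
  Real.sqrt (B v v)

/-- The largest value of `‖·‖_B` on the Euclidean unit sphere. -/
noncomputable def lambdaMax {n : ℕ}
    (B : LinearMap.BilinForm ℝ (EuclideanSpace ℝ (Fin n))) : ℝ :=
  sSup {a : ℝ | ∃ v : EuclideanSpace ℝ (Fin n), ‖v‖ = 1 ∧ a = formNorm B v}

/-- The smallest value of `‖·‖_B` on the Euclidean unit sphere. -/
noncomputable def lambdaMin {n : ℕ}
    (B : LinearMap.BilinForm ℝ (EuclideanSpace ℝ (Fin n))) : ℝ :=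
  sInf {a : ℝ | ∃ v : EuclideanSpace ℝ (Fin n), ‖v‖ = 1 ∧ a = formNorm B v}

/-- The condition number `κ_B` of an inner product `B`. -/
noncomputable def condNumber {n : ℕ}
    (B : LinearMap.BilinForm ℝ (EuclideanSpace ℝ (Fin n))) : ℝ :=
  lambdaMax B / lambdaMin B

/-- `g` is a (Riemannian) metric on `X`: an inner product at every point of `X`. No regularity in
the base point is required. Only the values of `g` on `X` matter. -/
def IsMetricOn {n : ℕ} (X : Set (EuclideanSpace ℝ (Fin n)))
    (g : EuclideanSpace ℝ (Fin n) → LinearMap.BilinForm ℝ (EuclideanSpace ℝ (Fin n))) : Prop :=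
  ∀ x ∈ X, IsInnerProduct (g x)

/-- The condition number of `g` is bounded above and away from zero near every point of `X`. -/
def LocallyWeaklyBoundedOn {n : ℕ} (X : Set (EuclideanSpace ℝ (Fin n)))
    (g : EuclideanSpace ℝ (Fin n) → LinearMap.BilinForm ℝ (EuclideanSpace ℝ (Fin n))) : Prop :=
  ∀ x ∈ X, ∃ l > (0 : ℝ), ∃ L > (0 : ℝ), ∀ᶠ y in 𝓝[X] x,
    l ≤ condNumber (g y) ∧ condNumber (g y) ≤ L

/-- The vector field `f` is locally bounded on `X`. Only the values of `f` on `X` matter. -/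
def LocallyBoundedOn {n : ℕ} (X : Set (EuclideanSpace ℝ (Fin n)))
    (f : EuclideanSpace ℝ (Fin n) → EuclideanSpace ℝ (Fin n)) : Prop :=
  ∀ x ∈ X, ∃ L > (0 : ℝ), ∀ᶠ y in 𝓝[X] x, ‖f y‖ ≤ L

/-- The (Bouligand) tangent cone of `X` at `x`. -/
def tangentCone {n : ℕ} (X : Set (EuclideanSpace ℝ (Fin n))) (x : EuclideanSpace ℝ (Fin n)) :
    Set (EuclideanSpace ℝ (Fin n)) :=
  {v | ∃ (u : ℕ → EuclideanSpace ℝ (Fin n)) (δ : ℕ → ℝ),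
    (∀ k, u k ∈ X) ∧ Tendsto u atTop (𝓝 x) ∧
    (∀ k, 0 < δ k) ∧ Tendsto δ atTop (𝓝 0) ∧
    Tendsto (fun k => (δ k)⁻¹ • (u k - x)) atTop (𝓝 v)}

/-- The projected vector field: all minimizers of `‖v - f x‖²_{g x}` over `v` in the tangent
cone of `X` at `x`. -/
def projectedField {n : ℕ} (X : Set (EuclideanSpace ℝ (Fin n)))
    (g : EuclideanSpace ℝ (Fin n) → LinearMap.BilinForm ℝ (EuclideanSpace ℝ (Fin n)))
    (f : EuclideanSpace ℝ (Fin n) → EuclideanSpace ℝ (Fin n)) (x : EuclideanSpace ℝ (Fin n)) :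
    Set (EuclideanSpace ℝ (Fin n)) :=
  {v | v ∈ tangentCone X x ∧
    IsMinOn (fun w => formNorm (g x) (w - f x) ^ 2) (tangentCone X x) v}

/-- The outer limit of a sequence of sets. -/
def seqOuterLimit {n : ℕ} (C : ℕ → Set (EuclideanSpace ℝ (Fin n))) :
    Set (EuclideanSpace ℝ (Fin n)) :=
  {v | ∃ (φ : ℕ → ℕ) (u : ℕ → EuclideanSpace ℝ (Fin n)), StrictMono φ ∧
    (∀ k, u k ∈ C (φ k)) ∧ Tendsto u atTop (𝓝 v)}

/-- The outer limit `limsup_{y → x} F y` of a set-valued map `F` on `X`: the union of the outer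
limits of `F (y 0), F (y 1), …` over all sequences in `X` that converge to `x`. -/
def outerLimit {n : ℕ} (X : Set (EuclideanSpace ℝ (Fin n)))
    (F : EuclideanSpace ℝ (Fin n) → Set (EuclideanSpace ℝ (Fin n)))
    (x : EuclideanSpace ℝ (Fin n)) : Set (EuclideanSpace ℝ (Fin n)) :=
  {v | ∃ y : ℕ → EuclideanSpace ℝ (Fin n), (∀ k, y k ∈ X) ∧ Tendsto y atTop (𝓝 x) ∧
    v ∈ seqOuterLimit (fun k => F (y k))}

/-- The Krasovskii regularization `K[F]` of a set-valued map `F` on `X`. -/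
def krasovskii {n : ℕ} (X : Set (EuclideanSpace ℝ (Fin n)))
    (F : EuclideanSpace ℝ (Fin n) → Set (EuclideanSpace ℝ (Fin n)))
    (x : EuclideanSpace ℝ (Fin n)) : Set (EuclideanSpace ℝ (Fin n)) :=
  closedConvexHull ℝ (outerLimit X F x)

/-- The interval `[0, T)` for an extended real number `T`. -/
def timeInterval (T : EReal) : Set ℝ :=
  {t | 0 ≤ t ∧ (t : EReal) < T}

/-- `x : [0, T) → X` is a Krasovskii solution in `X` of `ẋ ∈ F(x)`, `x(0) = x₀`, where
`0 < T ≤ ∞`: it is absolutely continuous (on every compact subinterval of `[0, T)`) and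
`ẋ(t) ∈ K[F](x(t))` for almost every `t`. Only the values of `x` on `[0, T)` matter. -/
structure IsKrasovskiiSolution {n : ℕ} (X : Set (EuclideanSpace ℝ (Fin n)))
    (F : EuclideanSpace ℝ (Fin n) → Set (EuclideanSpace ℝ (Fin n)))
    (x₀ : EuclideanSpace ℝ (Fin n)) (T : EReal) (x : ℝ → EuclideanSpace ℝ (Fin n)) : Prop where
  pos : 0 < T
  init : x 0 = x₀
  mem : ∀ t ∈ timeInterval T, x t ∈ X
  absCont : ∀ t ∈ timeInterval T, AbsolutelyContinuousOnInterval x 0 t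
  deriv_mem : ∀ᵐ t : ℝ, t ∈ timeInterval T → ∃ v ∈ krasovskii X F (x t), HasDerivAt x v t

end ProjDyn

/-! Comparing a minimiser `v` with the competitor `0` gives `‖v‖ ≤ (1 + κ) ‖f x‖`
(`norm_le_of_formNorm_sub_le`). So the projected field consists of tangent vectors, is nonempty
because the cone is closed, and is locally bounded; nothing more about `f` and `g` enters.

For any such field `F` one argues as in Nagumo's viability theorem. On a compact piece `K` of `X`,
tangent steps have sizes bounded below (`exists_uniform_step`), so Euler polygons with nodes in `X`
reach a fixed time. Their step functions converge pointwise along an ultrafilter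
(`exists_limit_solution`). The inclusion passes to the limit in dual form: if `ℓ ≤ c` on `F` near `z
s`, then `ℓ (z r - z s) ≤ c * (r - s)` for `r` slightly above `s`. Differentiating gives `ℓ (ż s) ≤
c`, and Hahn–Banach turns these half-space bounds into membership in `K[F]`.

Zorn's lemma yields a solution that cannot be continued. If its lifetime `T` were at most `r / L`,
it would stay in `U_r`, be `L`-Lipschitz, and have a limit at `T` in the closed set `U_r`;
restarting from there contradicts maximality. Hence the strict inequality. -/

namespace ProjDyn

variable {n : ℕ}

/-! ### The contingent cone -/

/-- The sequence-free form makes closedness an `ε / 2` argument and directly supplies Euler steps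
whose error is small relative to the step size. -/
theorem mem_tangentCone_iff {X : Set (EuclideanSpace ℝ (Fin n))}
    {x v : EuclideanSpace ℝ (Fin n)} :
    v ∈ tangentCone X x ↔ ∀ ε > (0 : ℝ), ∃ u ∈ X, ∃ δ : ℝ, 0 < δ ∧ δ < ε ∧
      ‖u - x - δ • v‖ < ε * δ := by
  constructor
  · rintro ⟨u, δ, hu, -, hδ, hδ0, hv⟩ ε hε
    have h1 : ∀ᶠ k in atTop, ‖(δ k)⁻¹ • (u k - x) - v‖ < ε := by
      simpa [dist_eq_norm] using (Metric.tendsto_nhds.1 hv) ε hε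
    obtain ⟨k, hk1, hk2⟩ := (h1.and (hδ0.eventually_lt_const hε)).exists
    refine ⟨u k, hu k, δ k, hδ k, hk2, ?_⟩
    have : u k - x - δ k • v = δ k • ((δ k)⁻¹ • (u k - x) - v) := by
      rw [smul_sub, smul_inv_smul₀ (hδ k).ne']
    rw [this, norm_smul, Real.norm_of_nonneg (hδ k).le, mul_comm]
    exact mul_lt_mul_of_pos_right hk1 (hδ k)
  · intro h
    choose u hu δ hδ hδε huv using fun k : ℕ => h (1 / ((k : ℝ) + 1)) (by positivity)
    have h0 : Tendsto (fun k : ℕ => 1 / ((k : ℝ) + 1)) atTop (𝓝 0) :=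
      tendsto_one_div_add_atTop_nhds_zero_nat
    have hδ0 : Tendsto δ atTop (𝓝 0) :=
      squeeze_zero (fun k => (hδ k).le) (fun k => (hδε k).le) h0
    have hq : Tendsto (fun k => (δ k)⁻¹ • (u k - x)) atTop (𝓝 v) := by
      rw [tendsto_iff_norm_sub_tendsto_zero]
      refine squeeze_zero (fun k => norm_nonneg _) (fun k => ?_) h0
      have : (δ k)⁻¹ • (u k - x) - v = (δ k)⁻¹ • (u k - x - δ k • v) := by
        rw [smul_sub _ (u k - x), inv_smul_smul₀ (hδ k).ne']
      rw [this, norm_smul, norm_inv, Real.norm_of_nonneg (hδ k).le, inv_mul_le_iff₀ (hδ k),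
        mul_comm]
      exact (huv k).le
    refine ⟨u, δ, hu, ?_, hδ, hδ0, hq⟩
    have h1 := (hδ0.smul hq).const_add x
    simp only [zero_smul, add_zero] at h1
    refine h1.congr fun k => ?_
    rw [smul_inv_smul₀ (hδ k).ne', add_sub_cancel]

theorem zero_mem_tangentCone {X : Set (EuclideanSpace ℝ (Fin n))}
    {x : EuclideanSpace ℝ (Fin n)} (hx : x ∈ X) : 0 ∈ tangentCone X x :=
  mem_tangentCone_iff.2 fun ε hε => ⟨x, hx, ε / 2, by positivity, by linarith, by
    simp only [sub_self, smul_zero, norm_zero]; positivity⟩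

theorem isClosed_tangentCone (X : Set (EuclideanSpace ℝ (Fin n)))
    (x : EuclideanSpace ℝ (Fin n)) : IsClosed (tangentCone X x) := by
  refine isClosed_of_closure_subset fun v hv => mem_tangentCone_iff.2 fun ε hε => ?_
  obtain ⟨w, hw, hvw⟩ := Metric.mem_closure_iff.1 hv (ε / 2) (by positivity)
  obtain ⟨u, hu, δ, hδ, hδε, h⟩ := mem_tangentCone_iff.1 hw (ε / 2) (by positivity)
  refine ⟨u, hu, δ, hδ, by linarith, ?_⟩
  have h1 : u - x - δ • v = (u - x - δ • w) - δ • (v - w) := by rw [smul_sub]; abel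
  rw [dist_eq_norm] at hvw
  calc ‖u - x - δ • v‖ ≤ ‖u - x - δ • w‖ + ‖δ • (v - w)‖ := by rw [h1]; exact norm_sub_le _ _
    _ = ‖u - x - δ • w‖ + δ * ‖v - w‖ := by rw [norm_smul, Real.norm_of_nonneg hδ.le]
    _ < ε / 2 * δ + δ * (ε / 2) := add_lt_add h (mul_lt_mul_of_pos_left hvw hδ)
    _ = ε * δ := by ring

/-! ### Comparison of inner product norms with the Euclidean norm -/

theorem continuous_formNorm (B : LinearMap.BilinForm ℝ (EuclideanSpace ℝ (Fin n))) :
    Continuous (formNorm B) := by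
  let C : EuclideanSpace ℝ (Fin n) →ₗ[ℝ] EuclideanSpace ℝ (Fin n) →L[ℝ] ℝ :=
    (LinearMap.toContinuousLinearMap : _ ≃ₗ[ℝ] _).toLinearMap ∘ₗ B
  have hC : Continuous C := C.continuous_of_finiteDimensional
  exact Real.continuous_sqrt.comp (hC.clm_apply continuous_id)

theorem formNorm_smul (B : LinearMap.BilinForm ℝ (EuclideanSpace ℝ (Fin n))) (a : ℝ)
    (v : EuclideanSpace ℝ (Fin n)) : formNorm B (a • v) = |a| * formNorm B v := by
  simp only [formNorm, map_smul, LinearMap.smul_apply, smul_eq_mul]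
  rw [← mul_assoc, Real.sqrt_mul (mul_self_nonneg a), Real.sqrt_mul_self_eq_abs]

theorem formNorm_nonneg (B : LinearMap.BilinForm ℝ (EuclideanSpace ℝ (Fin n)))
    (v : EuclideanSpace ℝ (Fin n)) : 0 ≤ formNorm B v :=
  Real.sqrt_nonneg _

theorem isCompact_formNorm_sphere (B : LinearMap.BilinForm ℝ (EuclideanSpace ℝ (Fin n))) :
    IsCompact {a : ℝ | ∃ v : EuclideanSpace ℝ (Fin n), ‖v‖ = 1 ∧ a = formNorm B v} := by
  convert (isCompact_sphere (0 : EuclideanSpace ℝ (Fin n)) 1).image (continuous_formNorm B)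
    using 1
  ext a
  simp [eq_comm]

theorem formNorm_eq_norm_mul (B : LinearMap.BilinForm ℝ (EuclideanSpace ℝ (Fin n)))
    {v : EuclideanSpace ℝ (Fin n)} (hv : v ≠ 0) :
    formNorm B v = ‖v‖ * formNorm B (‖v‖⁻¹ • v) := by
  rw [formNorm_smul, abs_inv, abs_norm, mul_inv_cancel_left₀ (norm_ne_zero_iff.2 hv)]

theorem formNorm_le_lambdaMax (B : LinearMap.BilinForm ℝ (EuclideanSpace ℝ (Fin n)))
    (v : EuclideanSpace ℝ (Fin n)) : formNorm B v ≤ lambdaMax B * ‖v‖ := by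
  rcases eq_or_ne v 0 with rfl | hv
  · simp [formNorm]
  rw [formNorm_eq_norm_mul B hv, mul_comm]
  refine mul_le_mul_of_nonneg_right ?_ (norm_nonneg v)
  exact le_csSup (isCompact_formNorm_sphere B).bddAbove ⟨_, norm_smul_inv_norm hv, rfl⟩

theorem lambdaMin_le_formNorm (B : LinearMap.BilinForm ℝ (EuclideanSpace ℝ (Fin n)))
    (v : EuclideanSpace ℝ (Fin n)) : lambdaMin B * ‖v‖ ≤ formNorm B v := by
  rcases eq_or_ne v 0 with rfl | hv
  · simp [formNorm]
  rw [formNorm_eq_norm_mul B hv, mul_comm]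
  refine mul_le_mul_of_nonneg_left ?_ (norm_nonneg v)
  exact csInf_le (isCompact_formNorm_sphere B).bddBelow ⟨_, norm_smul_inv_norm hv, rfl⟩

theorem lambdaMin_nonneg (B : LinearMap.BilinForm ℝ (EuclideanSpace ℝ (Fin n))) :
    0 ≤ lambdaMin B :=
  Real.sInf_nonneg (by rintro a ⟨v, -, rfl⟩; exact formNorm_nonneg _ _)

/-- A vector that is no farther from `w` than the origin, in the norm of `B`, has norm at most
`(1 + κ_B) ‖w‖`. -/
theorem norm_le_of_formNorm_sub_le {B : LinearMap.BilinForm ℝ (EuclideanSpace ℝ (Fin n))}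
    (hB : 0 < condNumber B) {v w : EuclideanSpace ℝ (Fin n)}
    (h : formNorm B (v - w) ≤ formNorm B (0 - w)) : ‖v‖ ≤ (1 + condNumber B) * ‖w‖ := by
  -- Division by zero yields zero, so a positive condition number forces a nonzero denominator.
  have hpos : 0 < lambdaMin B := by
    refine (lambdaMin_nonneg B).lt_of_ne fun h0 => hB.ne' ?_
    rw [condNumber, ← h0, div_zero]
  have h1 : lambdaMin B * ‖v - w‖ ≤ lambdaMax B * ‖w‖ := by
    have h2 := (lambdaMin_le_formNorm B (v - w)).trans (h.trans (formNorm_le_lambdaMax B _))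
    rwa [zero_sub, norm_neg] at h2
  have h3 : ‖v - w‖ ≤ condNumber B * ‖w‖ := by
    rw [condNumber, div_mul_eq_mul_div, le_div_iff₀ hpos, mul_comm]
    exact h1
  calc ‖v‖ = ‖(v - w) + w‖ := by rw [sub_add_cancel]
    _ ≤ ‖v - w‖ + ‖w‖ := norm_add_le _ _
    _ ≤ (1 + condNumber B) * ‖w‖ := by linarith

/-! ### Existence and local bounds for projected vectors -/

/-- Outside a bounded set the objective exceeds its value at the origin, which lies in the closed
cone; coercivity gives a minimiser. -/
theorem projectedField_nonempty {X : Set (EuclideanSpace ℝ (Fin n))}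
    {g : EuclideanSpace ℝ (Fin n) → LinearMap.BilinForm ℝ (EuclideanSpace ℝ (Fin n))}
    (f : EuclideanSpace ℝ (Fin n) → EuclideanSpace ℝ (Fin n)) {x : EuclideanSpace ℝ (Fin n)}
    (hx : x ∈ X) (hg : 0 < condNumber (g x)) : (projectedField X g f x).Nonempty := by
  have hc : Continuous fun w => formNorm (g x) (w - f x) ^ 2 :=
    ((continuous_formNorm (g x)).comp (continuous_id.sub continuous_const)).pow 2
  obtain ⟨v, hv, hmin⟩ := hc.continuousOn.exists_isMinOn' (isClosed_tangentCone X x)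
    (zero_mem_tangentCone hx) (by
      refine Filter.Eventually.filter_mono inf_le_left ?_
      have h := (tendsto_norm_cocompact_atTop (E := EuclideanSpace ℝ (Fin n))).eventually_gt_atTop
        ((1 + condNumber (g x)) * ‖f x‖)
      filter_upwards [h] with w hw
      by_contra hlt
      rw [not_le, sq_lt_sq₀ (formNorm_nonneg _ _) (formNorm_nonneg _ _)] at hlt
      exact hw.not_ge (norm_le_of_formNorm_sub_le hg hlt.le))
  exact ⟨v, hv, hmin⟩

theorem norm_le_of_mem_projectedField {X : Set (EuclideanSpace ℝ (Fin n))}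
    {g : EuclideanSpace ℝ (Fin n) → LinearMap.BilinForm ℝ (EuclideanSpace ℝ (Fin n))}
    {f : EuclideanSpace ℝ (Fin n) → EuclideanSpace ℝ (Fin n)} {x v : EuclideanSpace ℝ (Fin n)}
    (hx : x ∈ X) (hg : 0 < condNumber (g x)) (hv : v ∈ projectedField X g f x) :
    ‖v‖ ≤ (1 + condNumber (g x)) * ‖f x‖ := by
  refine norm_le_of_formNorm_sub_le hg ?_
  have h : formNorm (g x) (v - f x) ^ 2 ≤ formNorm (g x) (0 - f x) ^ 2 :=
    hv.2 (zero_mem_tangentCone hx)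
  exact (sq_le_sq₀ (formNorm_nonneg _ _) (formNorm_nonneg _ _)).1 h

/-- A set-valued map on `X` selecting nonempty sets of tangent vectors that are locally bounded. -/
structure IsLocallyBoundedTangentField (X : Set (EuclideanSpace ℝ (Fin n)))
    (F : EuclideanSpace ℝ (Fin n) → Set (EuclideanSpace ℝ (Fin n))) : Prop where
  nonempty : ∀ x ∈ X, (F x).Nonempty
  subset : ∀ x ∈ X, F x ⊆ tangentCone X x
  bounded : ∀ x ∈ X, ∃ M > (0 : ℝ), ∃ ρ > (0 : ℝ), ∀ y ∈ X, ‖y - x‖ ≤ ρ → ∀ v ∈ F y, ‖v‖ ≤ M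

theorem isLocallyBoundedTangentField_projectedField {X : Set (EuclideanSpace ℝ (Fin n))}
    {f : EuclideanSpace ℝ (Fin n) → EuclideanSpace ℝ (Fin n)} (hf : LocallyBoundedOn X f)
    {g : EuclideanSpace ℝ (Fin n) → LinearMap.BilinForm ℝ (EuclideanSpace ℝ (Fin n))}
    (hgb : LocallyWeaklyBoundedOn X g) :
    IsLocallyBoundedTangentField X (projectedField X g f) := by
  have hpos : ∀ x ∈ X, 0 < condNumber (g x) := fun x hx => by
    obtain ⟨l, hl, L, hL, h⟩ := hgb x hx
    exact hl.trans_le (h.self_of_nhdsWithin hx).1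
  refine ⟨fun x hx => projectedField_nonempty f hx (hpos x hx), fun x hx v hv => hv.1,
    fun x hx => ?_⟩
  obtain ⟨l, hl, κ, hκ, h1⟩ := hgb x hx
  obtain ⟨L, hL, h2⟩ := hf x hx
  obtain ⟨ρ, hρ, hball⟩ := Metric.mem_nhdsWithin_iff.1 (h1.and h2)
  refine ⟨(1 + κ) * L, by positivity, ρ / 2, by positivity, fun y hy hyx v hv => ?_⟩
  obtain ⟨⟨h3, h4⟩, h5⟩ := hball ⟨by rw [Metric.mem_ball, dist_eq_norm]; linarith, hy⟩
  refine (norm_le_of_mem_projectedField hy (hpos y hy) hv).trans ?_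
  gcongr

/-! ### Euler polygons -/

/-- Steps along tangent directions can be taken with step sizes that are bounded below uniformly on
a compact set, if the direction may be selected at a nearby point. -/
theorem exists_uniform_step {X K : Set (EuclideanSpace ℝ (Fin n))}
    {F : EuclideanSpace ℝ (Fin n) → Set (EuclideanSpace ℝ (Fin n))}
    (hF : IsLocallyBoundedTangentField X F) (hKX : K ⊆ X) (hK : IsCompact K) {ε : ℝ}
    (hε : 0 < ε) :
    ∃ δ₀ > (0 : ℝ), ∀ x ∈ K, ∃ δ : ℝ, δ₀ ≤ δ ∧ δ ≤ ε ∧ ∃ u ∈ X, ∃ y ∈ K, ‖y - x‖ ≤ ε ∧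
      ∃ v ∈ F y, ‖u - x - δ • v‖ ≤ ε * δ := by
  refine hK.induction_on (p := fun S => ∃ δ₀ > (0 : ℝ), ∀ x ∈ S, ∃ δ : ℝ, δ₀ ≤ δ ∧ δ ≤ ε ∧
    ∃ u ∈ X, ∃ y ∈ K, ‖y - x‖ ≤ ε ∧ ∃ v ∈ F y, ‖u - x - δ • v‖ ≤ ε * δ) ?_ ?_ ?_ ?_
  · exact ⟨1, one_pos, fun x hx => hx.elim⟩
  · rintro S S' hS ⟨δ₀, h0, h⟩
    exact ⟨δ₀, h0, fun x hx => h x (hS hx)⟩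
  · rintro S S' ⟨δ₁, h1, h1'⟩ ⟨δ₂, h2, h2'⟩
    refine ⟨min δ₁ δ₂, lt_min h1 h2, fun x hx => ?_⟩
    rcases hx with hx | hx
    · obtain ⟨δ, hδ, h⟩ := h1' x hx
      exact ⟨δ, (min_le_left _ _).trans hδ, h⟩
    · obtain ⟨δ, hδ, h⟩ := h2' x hx
      exact ⟨δ, (min_le_right _ _).trans hδ, h⟩
  · intro y hy
    obtain ⟨v, hv⟩ := hF.nonempty y (hKX hy)
    obtain ⟨u, hu, δ, hδ, hδε, huv⟩ := mem_tangentCone_iff.1 (hF.subset y (hKX hy) hv)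
      (min 1 (ε / 2)) (by positivity)
    have hδ1 : δ < 1 := hδε.trans_le (min_le_left _ _)
    have hδ2 : δ < ε / 2 := hδε.trans_le (min_le_right _ _)
    have huv' : ‖u - y - δ • v‖ ≤ ε / 2 * δ :=
      huv.le.trans (mul_le_mul_of_nonneg_right (min_le_right _ _) hδ.le)
    -- One step from `y` to `u` serves every `x` in this ball: moving the base point costs at most
    -- `ε / 2 * δ`, the other half of the error budget. Finitely many balls cover `K`.
    refine ⟨Metric.ball y (ε / 2 * δ),
      mem_nhdsWithin_of_mem_nhds (Metric.ball_mem_nhds y (by positivity)), δ, hδ,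
      fun x hx => ⟨δ, le_rfl, by linarith, u, hu, y, hy, ?_, v, hv, ?_⟩⟩
    · rw [Metric.mem_ball, dist_comm, dist_eq_norm] at hx
      nlinarith
    · rw [Metric.mem_ball, dist_comm, dist_eq_norm] at hx
      have : u - x - δ • v = (u - y - δ • v) + (y - x) := by abel
      rw [this]
      linarith [norm_add_le (u - y - δ • v) (y - x)]

/-- An Euler polygon in `X` with step sizes between `δ₀` and `ε`. -/
structure IsEulerPolygon (X K : Set (EuclideanSpace ℝ (Fin n)))
    (F : EuclideanSpace ℝ (Fin n) → Set (EuclideanSpace ℝ (Fin n)))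
    (x₀ : EuclideanSpace ℝ (Fin n)) (δ₀ ε : ℝ) (t : ℕ → ℝ)
    (x : ℕ → EuclideanSpace ℝ (Fin n)) : Prop where
  time_zero : t 0 = 0
  node_zero : x 0 = x₀
  pos : 0 < δ₀
  mem : ∀ j, x j ∈ X
  le_step : ∀ j, t j + δ₀ ≤ t (j + 1)
  step_le : ∀ j, t (j + 1) ≤ t j + ε
  step : ∀ j, x j ∈ K → ∃ y ∈ K, ‖y - x j‖ ≤ ε ∧ ∃ v ∈ F y,
    ‖x (j + 1) - x j - (t (j + 1) - t j) • v‖ ≤ ε * (t (j + 1) - t j)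

theorem exists_isEulerPolygon {X K : Set (EuclideanSpace ℝ (Fin n))}
    {F : EuclideanSpace ℝ (Fin n) → Set (EuclideanSpace ℝ (Fin n))}
    (hF : IsLocallyBoundedTangentField X F) (hKX : K ⊆ X) (hK : IsCompact K)
    {x₀ : EuclideanSpace ℝ (Fin n)} (hx₀ : x₀ ∈ X) {ε : ℝ} (hε : 0 < ε) :
    ∃ δ₀ t x, IsEulerPolygon X K F x₀ δ₀ ε t x := by
  obtain ⟨δ₀, hδ₀, h⟩ := exists_uniform_step hF hKX hK hε
  -- Outside `K` a dummy step of length `ε` without motion makes the recursion total.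
  have h' : ∀ x, ∃ δ : ℝ, ∃ u, min δ₀ ε ≤ δ ∧ δ ≤ ε ∧ (x ∈ X → u ∈ X) ∧ (x ∈ K → ∃ y ∈ K,
      ‖y - x‖ ≤ ε ∧ ∃ v ∈ F y, ‖u - x - δ • v‖ ≤ ε * δ) := by
    intro x
    by_cases hx : x ∈ K
    · obtain ⟨δ, h1, h2, u, hu, h3⟩ := h x hx
      exact ⟨δ, u, (min_le_left _ _).trans h1, h2, fun _ => hu, fun _ => h3⟩
    · exact ⟨ε, x, min_le_right _ _, le_rfl, id, fun h => (hx h).elim⟩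
  choose δ u h1 h2 h3 h4 using h'
  refine ⟨min δ₀ ε, fun j => ∑ i ∈ Finset.range j, δ (u^[i] x₀), fun j => u^[j] x₀, by simp, rfl,
    lt_min hδ₀ hε, fun j => ?_, fun j => ?_, fun j => ?_, fun j hj => ?_⟩
  · induction j with
    | zero => exact hx₀
    | succ j ih => rw [Function.iterate_succ_apply']; exact h3 _ ih
  · rw [Finset.sum_range_succ]; linarith [h1 (u^[j] x₀)]
  · rw [Finset.sum_range_succ]; linarith [h2 (u^[j] x₀)]
  · rw [Function.iterate_succ_apply', Finset.sum_range_succ, add_sub_cancel_left]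
    exact h4 _ hj

namespace IsEulerPolygon

variable {X K : Set (EuclideanSpace ℝ (Fin n))}
  {F : EuclideanSpace ℝ (Fin n) → Set (EuclideanSpace ℝ (Fin n))}
  {x₀ : EuclideanSpace ℝ (Fin n)} {δ₀ ε M ρ τ : ℝ} {t : ℕ → ℝ}
  {x : ℕ → EuclideanSpace ℝ (Fin n)}

theorem strictMono (h : IsEulerPolygon X K F x₀ δ₀ ε t x) : StrictMono t :=
  strictMono_nat_of_lt_succ fun j => by linarith [h.le_step j, h.pos]

theorem exists_index (h : IsEulerPolygon X K F x₀ δ₀ ε t x) {s : ℝ} (hs : 0 ≤ s) :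
    ∃ N, t N ≤ s ∧ s < t (N + 1) := by
  have hlow : ∀ j : ℕ, j * δ₀ ≤ t j := by
    intro j
    induction j with
    | zero => simp [h.time_zero]
    | succ j ih => push_cast; linarith [h.le_step j]
  have hex : ∃ j, s < t (j + 1) := by
    obtain ⟨j, hj⟩ := exists_nat_gt (s / δ₀)
    refine ⟨j, ?_⟩
    rw [div_lt_iff₀ h.pos] at hj
    linarith [hlow j, h.le_step j, h.pos]
  classical
  refine ⟨Nat.find hex, ?_, Nat.find_spec hex⟩
  rcases hN : Nat.find hex with _ | m
  · rwa [h.time_zero]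
  · exact not_lt.1 (Nat.find_min hex (by omega))

/-- Containment and the speed bound feed each other: a node in `K` takes a velocity of norm at most
`M`, and up to time `τ` the resulting speed keeps the next node in the ball. The extra `1` in `M +
1` absorbs the relative step error `ε ≤ 1`. -/
theorem norm_sub_le_and_mem (h : IsEulerPolygon X K F x₀ δ₀ ε t x)
    (hK : X ∩ Metric.closedBall x₀ ρ ⊆ K) (hM : ∀ y ∈ K, ∀ v ∈ F y, ‖v‖ ≤ M)
    (hM0 : 0 ≤ M) (hε : ε ≤ 1) (hτ : (M + 1) * τ ≤ ρ) (j : ℕ) (hj : t j ≤ τ) :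
    x j ∈ K ∧ ∀ i ≤ j, ‖x j - x i‖ ≤ (M + 1) * (t j - t i) := by
  have key : ∀ j, t j ≤ τ → ‖x j - x 0‖ ≤ (M + 1) * (t j - t 0) → x j ∈ K := by
    intro j hj h1
    refine hK ⟨h.mem j, ?_⟩
    rw [h.time_zero, sub_zero, h.node_zero] at h1
    rw [Metric.mem_closedBall, dist_eq_norm]
    nlinarith
  suffices ∀ i ≤ j, ‖x j - x i‖ ≤ (M + 1) * (t j - t i) from ⟨key j hj (this 0 j.zero_le), this⟩
  induction j with
  | zero => intro i hi; simp [Nat.le_zero.1 hi]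
  | succ j ih =>
    have hlt := h.strictMono (Nat.lt_succ_self j)
    have ih' := ih (hlt.le.trans hj)
    obtain ⟨y, hy, -, v, hv, hst⟩ := h.step j (key j (hlt.le.trans hj) (ih' 0 j.zero_le))
    intro i hi
    rcases Nat.of_le_succ hi with hi | rfl
    · have h1 : x (j + 1) - x i = (x (j + 1) - x j - (t (j + 1) - t j) • v)
          + (t (j + 1) - t j) • v + (x j - x i) := by abel
      have h2 : ‖(t (j + 1) - t j) • v‖ ≤ (t (j + 1) - t j) * M := by
        rw [norm_smul, Real.norm_of_nonneg (sub_pos.2 hlt).le]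
        exact mul_le_mul_of_nonneg_left (hM y hy v hv) (sub_pos.2 hlt).le
      have h3 := norm_add₃_le (a := x (j + 1) - x j - (t (j + 1) - t j) • v)
        (b := (t (j + 1) - t j) • v) (c := x j - x i)
      rw [h1]
      have h4 : ε * (t (j + 1) - t j) ≤ 1 * (t (j + 1) - t j) :=
        mul_le_mul_of_nonneg_right hε (sub_pos.2 hlt).le
      nlinarith [ih' i hi]
    · simp

/-- Summed over the steps, this is the dual form of the inclusion: all velocities used between `t i`
and `t j` are selected within travel distance plus `ε` of `x i`. -/
theorem apply_sub_le (h : IsEulerPolygon X K F x₀ δ₀ ε t x)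
    (hK : X ∩ Metric.closedBall x₀ ρ ⊆ K) (hM : ∀ y ∈ K, ∀ v ∈ F y, ‖v‖ ≤ M)
    (hM0 : 0 ≤ M) (hε : ε ≤ 1) (hτ : (M + 1) * τ ≤ ρ)
    (ℓ : StrongDual ℝ (EuclideanSpace ℝ (Fin n))) (c : ℝ) {i j : ℕ} (hij : i ≤ j)
    (hj : t j ≤ τ) (hc : ∀ y ∈ K, ‖y - x i‖ ≤ (M + 1) * (t j - t i) + ε → ∀ v ∈ F y, ℓ v ≤ c) :
    ℓ (x j - x i) ≤ (c + ε * ‖ℓ‖) * (t j - t i) := by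
  induction j, hij using Nat.le_induction with
  | base => simp
  | succ j hij ih =>
    have hlt := h.strictMono (Nat.lt_succ_self j)
    have hnode := h.norm_sub_le_and_mem hK hM hM0 hε hτ j (hlt.le.trans hj)
    have hle : (M + 1) * (t j - t i) ≤ (M + 1) * (t (j + 1) - t i) :=
      mul_le_mul_of_nonneg_left (by linarith) (by linarith)
    have ih' := ih (hlt.le.trans hj) fun y hy hyx => hc y hy (by linarith)
    obtain ⟨y, hy, hyx, v, hv, hst⟩ := h.step j hnode.1
    have hv' : ℓ v ≤ c := by
      refine hc y hy ?_ v hv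
      have : y - x i = (y - x j) + (x j - x i) := by abel
      rw [this]
      linarith [norm_add_le (y - x j) (x j - x i), hnode.2 i hij]
    have h1 : x (j + 1) - x i = (x (j + 1) - x j - (t (j + 1) - t j) • v)
        + (t (j + 1) - t j) • v + (x j - x i) := by abel
    have h2 : ℓ (x (j + 1) - x j - (t (j + 1) - t j) • v) ≤ ‖ℓ‖ * (ε * (t (j + 1) - t j)) :=
      (le_abs_self _).trans ((ℓ.le_opNorm _).trans
        (mul_le_mul_of_nonneg_left hst (norm_nonneg _)))
    rw [h1, map_add, map_add, map_smul, smul_eq_mul]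
    nlinarith [mul_le_mul_of_nonneg_left hv' (sub_pos.2 hlt).le]

end IsEulerPolygon

/-- Step functions of Euler polygons: approximate solutions with values in a compact set. -/
theorem exists_approximate_solution {X K : Set (EuclideanSpace ℝ (Fin n))}
    {F : EuclideanSpace ℝ (Fin n) → Set (EuclideanSpace ℝ (Fin n))}
    (hF : IsLocallyBoundedTangentField X F) (hKX : K ⊆ X) (hKc : IsCompact K)
    {x₀ : EuclideanSpace ℝ (Fin n)} (hx₀ : x₀ ∈ X) {M ρ τ : ℝ}
    (hK : X ∩ Metric.closedBall x₀ ρ ⊆ K) (hM : ∀ y ∈ K, ∀ v ∈ F y, ‖v‖ ≤ M)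
    (hM0 : 0 ≤ M) (hτ : (M + 1) * τ ≤ ρ) {ε : ℝ} (hε : 0 < ε) (hε1 : ε ≤ 1) :
    ∃ φ : ℝ → EuclideanSpace ℝ (Fin n), φ 0 = x₀ ∧ (∀ s ∈ Icc 0 τ, φ s ∈ K) ∧
      ∀ s r, 0 ≤ s → s ≤ r → r ≤ τ → ‖φ r - φ s‖ ≤ (M + 1) * (r - s + ε) ∧
        ∀ (ℓ : StrongDual ℝ (EuclideanSpace ℝ (Fin n))) (c : ℝ),
          (∀ y ∈ K, ‖y - φ s‖ ≤ (M + 1) * (r - s + ε) + ε → ∀ v ∈ F y, ℓ v ≤ c) →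
          ℓ (φ r - φ s) ≤ c * (r - s) + (|c| + ‖ℓ‖ * (r - s + ε)) * ε := by
  obtain ⟨δ₀, t, x, h⟩ := exists_isEulerPolygon hF hKX hKc hx₀ hε
  have hN : ∀ s : ℝ, ∃ N, 0 ≤ s → t N ≤ s ∧ s < t (N + 1) := fun s => by
    by_cases hs : 0 ≤ s
    · obtain ⟨N, hN⟩ := h.exists_index hs
      exact ⟨N, fun _ => hN⟩
    · exact ⟨0, fun h => (hs h).elim⟩
  choose N hN using hN
  have hmem : ∀ s ∈ Icc 0 τ, x (N s) ∈ K := fun s hs =>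
    (h.norm_sub_le_and_mem hK hM hM0 hε1 hτ _ ((hN s hs.1).1.trans hs.2)).1
  -- Piecewise constant rather than affine interpolation keeps all values in `K`; the jumps vanish
  -- with `ε`.
  refine ⟨fun s => x (N s), ?_, hmem, fun s r hs hsr hr => ?_⟩
  · have h0 : t (N 0) ≤ t 0 := by rw [h.time_zero]; exact (hN 0 le_rfl).1
    rw [h.strictMono.le_iff_le, Nat.le_zero] at h0
    simp only [h0, h.node_zero]
  obtain ⟨hs1, hs2⟩ := hN s hs
  obtain ⟨hr1, hr2⟩ := hN r (hs.trans hsr)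
  have hNle : N s ≤ N r := Nat.lt_succ_iff.1 (h.strictMono.lt_iff_lt.1 (by linarith))
  have hup : t (N r) - t (N s) ≤ r - s + ε := by linarith [h.step_le (N s)]
  have hlo : r - s - ε ≤ t (N r) - t (N s) := by linarith [h.step_le (N r)]
  have hnn : 0 ≤ t (N r) - t (N s) := sub_nonneg.2 (h.strictMono.monotone hNle)
  have hup' : (M + 1) * (t (N r) - t (N s)) ≤ (M + 1) * (r - s + ε) :=
    mul_le_mul_of_nonneg_left hup (by linarith)
  refine ⟨((h.norm_sub_le_and_mem hK hM hM0 hε1 hτ _ (hr1.trans hr)).2 _ hNle).trans hup',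
    fun ℓ c hc => ?_⟩
  have h1 := h.apply_sub_le hK hM hM0 hε1 hτ ℓ c hNle (hr1.trans hr) fun y hy hyx =>
    hc y hy (by linarith)
  have h2 : c * (t (N r) - t (N s) - (r - s)) ≤ |c| * ε := by
    refine (le_abs_self _).trans ?_
    rw [abs_mul]
    exact mul_le_mul_of_nonneg_left (abs_le.2 ⟨by linarith, by linarith⟩) (abs_nonneg c)
  have h3 : ε * ‖ℓ‖ * (t (N r) - t (N s)) ≤ ε * ‖ℓ‖ * (r - s + ε) :=
    mul_le_mul_of_nonneg_left hup (by positivity)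
  linarith

/-! ### Passage to the limit -/

/-- Separation criterion for membership in the Krasovskii regularization. -/
theorem mem_krasovskii_of_forall_apply_le {X : Set (EuclideanSpace ℝ (Fin n))}
    {F : EuclideanSpace ℝ (Fin n) → Set (EuclideanSpace ℝ (Fin n))}
    (hF : IsLocallyBoundedTangentField X F) {x w : EuclideanSpace ℝ (Fin n)} (hx : x ∈ X)
    (h : ∀ (ℓ : StrongDual ℝ (EuclideanSpace ℝ (Fin n))) (c η : ℝ), 0 < η →
      (∀ y ∈ X, ‖y - x‖ ≤ η → ∀ v ∈ F y, ℓ v ≤ c) → ℓ w ≤ c) :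
    w ∈ krasovskii X F x := by
  by_contra hw
  obtain ⟨ℓ, c, hc, hcw⟩ := geometric_hahn_banach_closed_point
    (convex_closedConvexHull (𝕜 := ℝ) (s := outerLimit X F x)) isClosed_closedConvexHull hw
  obtain ⟨M, hM, ρ, hρ, hbd⟩ := hF.bounded x hx
  have hex : ∀ k : ℕ, ∃ y ∈ X, ‖y - x‖ ≤ min ρ (1 / ((k : ℝ) + 1)) ∧ ∃ v ∈ F y, c < ℓ v := by
    intro k
    by_contra! hk
    exact hcw.not_ge (h ℓ c _ (lt_min hρ (by positivity)) hk)
  choose y hy hyx v hv hcv using hex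
  have hvM : ∀ k, v k ∈ Metric.closedBall (0 : EuclideanSpace ℝ (Fin n)) M := fun k => by
    rw [mem_closedBall_zero_iff]
    exact hbd (y k) (hy k) ((hyx k).trans (min_le_left _ _)) (v k) (hv k)
  obtain ⟨v₀, -, ψ, hψ, hlim⟩ := (isCompact_closedBall _ _).tendsto_subseq hvM
  have hyl : Tendsto y atTop (𝓝 x) := by
    rw [tendsto_iff_norm_sub_tendsto_zero]
    exact squeeze_zero (fun k => norm_nonneg _) (fun k => (hyx k).trans (min_le_right _ _))
      tendsto_one_div_add_atTop_nhds_zero_nat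
  have hmem : v₀ ∈ outerLimit X F x := ⟨y, hy, hyl, ψ, v ∘ ψ, hψ, fun k => hv (ψ k), hlim⟩
  have hge : c ≤ ℓ v₀ :=
    ge_of_tendsto ((ℓ.continuous.tendsto v₀).comp hlim) (Eventually.of_forall fun k =>
      (hcv (ψ k)).le)
  exact (hc v₀ (subset_closedConvexHull hmem)).not_ge hge

/-- A limit of Euler polygons. -/
theorem exists_limit_solution {X K : Set (EuclideanSpace ℝ (Fin n))}
    {F : EuclideanSpace ℝ (Fin n) → Set (EuclideanSpace ℝ (Fin n))}
    (hF : IsLocallyBoundedTangentField X F) (hKX : K ⊆ X) (hKc : IsCompact K)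
    {x₀ : EuclideanSpace ℝ (Fin n)} (hx₀ : x₀ ∈ X) {M ρ τ : ℝ}
    (hK : X ∩ Metric.closedBall x₀ ρ ⊆ K) (hM : ∀ y ∈ K, ∀ v ∈ F y, ‖v‖ ≤ M)
    (hM0 : 0 ≤ M) (hτ0 : 0 ≤ τ) (hτ : (M + 1) * τ ≤ ρ) :
    ∃ z : ℝ → EuclideanSpace ℝ (Fin n), z 0 = x₀ ∧ (∀ s ∈ Icc 0 τ, z s ∈ K) ∧
      ∀ s r, 0 ≤ s → s ≤ r → r ≤ τ → ‖z r - z s‖ ≤ (M + 1) * (r - s) ∧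
        ∀ (ℓ : StrongDual ℝ (EuclideanSpace ℝ (Fin n))) (c η : ℝ), (M + 1) * (r - s) < η →
          (∀ y ∈ K, ‖y - z s‖ ≤ η → ∀ v ∈ F y, ℓ v ≤ c) → ℓ (z r - z s) ≤ c * (r - s) := by
  choose φ hφ0 hφK hφ using fun k : ℕ => exists_approximate_solution hF hKX hKc hx₀ hK hM hM0 hτ
    (ε := 1 / ((k : ℝ) + 1)) (by positivity)
    (by rw [div_le_one (by positivity)]; linarith [k.cast_nonneg (α := ℝ)])
  -- A free ultrafilter gives limits at all times at once, replacing Arzelà–Ascoli and diagonal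
  -- subsequences.
  have hε : Tendsto (fun k : ℕ => 1 / ((k : ℝ) + 1)) (hyperfilter ℕ) (𝓝 0) :=
    tendsto_one_div_add_atTop_nhds_zero_nat.mono_left Nat.hyperfilter_le_atTop
  have hlim : ∀ s, ∃ z, s ∈ Icc 0 τ → z ∈ K ∧ Tendsto (fun k => φ k s) (hyperfilter ℕ) (𝓝 z) := by
    intro s
    by_cases hs : s ∈ Icc 0 τ
    · obtain ⟨z, hz, h⟩ := hKc.ultrafilter_le_nhds ((hyperfilter ℕ).map fun k => φ k s)
        (le_principal_iff.2 (show ∀ᶠ k in (hyperfilter ℕ : Filter ℕ), φ k s ∈ K from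
          Eventually.of_forall fun k => hφK k s hs))
      exact ⟨z, fun _ => ⟨hz, h⟩⟩
    · exact ⟨0, fun h => (hs h).elim⟩
  choose z hz using hlim
  refine ⟨z, ?_, fun s hs => (hz s hs).1, fun s r hs hsr hr => ?_⟩
  · refine tendsto_nhds_unique (hz 0 ⟨le_rfl, hτ0⟩).2 ?_
    simp only [hφ0, tendsto_const_nhds]
  have hzs := (hz s ⟨hs, hsr.trans hr⟩).2
  have hzr := (hz r ⟨hs.trans hsr, hr⟩).2
  refine ⟨?_, fun ℓ c η hη hc => ?_⟩
  · have h1 := ((hε.const_add (r - s)).const_mul (M + 1))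
    rw [add_zero] at h1
    exact le_of_tendsto_of_tendsto (hzr.sub hzs).norm h1
      (Eventually.of_forall fun k => (hφ k s r hs hsr hr).1)
  · have h1 : Tendsto (fun k : ℕ => c * (r - s) +
        (|c| + ‖ℓ‖ * (r - s + 1 / ((k : ℝ) + 1))) * (1 / ((k : ℝ) + 1))) (hyperfilter ℕ)
        (𝓝 (c * (r - s) + (|c| + ‖ℓ‖ * (r - s + 0)) * 0)) :=
      ((((hε.const_add _).const_mul _).const_add _).mul hε).const_add _
    rw [mul_zero, add_zero] at h1
    -- The strict inequality `hη` leaves room for the errors in `ε` and for replacing `φ k s` by `z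
    -- s`.
    have h2 : Tendsto (fun k : ℕ => (M + 1) * (r - s + 1 / ((k : ℝ) + 1)) + 1 / ((k : ℝ) + 1) +
        ‖φ k s - z s‖) (hyperfilter ℕ) (𝓝 ((M + 1) * (r - s + 0) + 0 + ‖z s - z s‖)) :=
      (((hε.const_add _).const_mul _).add hε).add (hzs.sub_const _).norm
    rw [sub_self, norm_zero, add_zero, add_zero, add_zero] at h2
    refine le_of_tendsto_of_tendsto ((ℓ.continuous.tendsto _).comp (hzr.sub hzs)) h1 ?_
    filter_upwards [h2.eventually_lt_const hη] with k hk
    refine (hφ k s r hs hsr hr).2 ℓ c fun y hy hyx => hc y hy ?_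
    have : y - z s = (y - φ k s) + (φ k s - z s) := by abel
    rw [this]
    linarith [norm_add_le (y - φ k s) (φ k s - z s)]

/-! ### Local existence and Lipschitz curves -/

/-- A Lipschitz Krasovskii solution on the compact interval `[0, a]`. -/
structure IsLipschitzSolutionOn (X : Set (EuclideanSpace ℝ (Fin n)))
    (F : EuclideanSpace ℝ (Fin n) → Set (EuclideanSpace ℝ (Fin n))) (a : ℝ)
    (x : ℝ → EuclideanSpace ℝ (Fin n)) : Prop where
  lipschitz : ∃ C, LipschitzOnWith C x (Icc 0 a)
  mem : ∀ t ∈ Icc 0 a, x t ∈ X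
  deriv_mem : ∀ᵐ t : ℝ, t ∈ Ioo 0 a → ∃ v ∈ krasovskii X F (x t), HasDerivAt x v t

theorem exists_isCompact_inter_closedBall {X : Set (EuclideanSpace ℝ (Fin n))}
    (hX : IsLocallyClosed X) {x : EuclideanSpace ℝ (Fin n)} (hx : x ∈ X) :
    ∃ ρ₀ > (0 : ℝ), ∀ ρ ≤ ρ₀, IsCompact (X ∩ Metric.closedBall x ρ) := by
  obtain ⟨U, Z, hU, hZ, rfl⟩ := hX
  obtain ⟨ρ₀, hρ₀, hball⟩ := Metric.nhds_basis_closedBall.mem_iff.1 (hU.mem_nhds hx.1)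
  refine ⟨ρ₀, hρ₀, fun ρ hρ => ?_⟩
  have : U ∩ Z ∩ Metric.closedBall x ρ = Z ∩ Metric.closedBall x ρ := by
    ext y
    exact ⟨fun h => ⟨h.1.2, h.2⟩,
      fun h => ⟨⟨hball (Metric.closedBall_subset_closedBall hρ h.2), h.1⟩, h.2⟩⟩
  rw [this]
  exact (isCompact_closedBall x ρ).inter_left hZ

/-- Local existence of viable solutions. -/
theorem exists_isLipschitzSolutionOn {X : Set (EuclideanSpace ℝ (Fin n))}
    (hX : IsLocallyClosed X)
    {F : EuclideanSpace ℝ (Fin n) → Set (EuclideanSpace ℝ (Fin n))}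
    (hF : IsLocallyBoundedTangentField X F) {x₀ : EuclideanSpace ℝ (Fin n)} (hx₀ : x₀ ∈ X) :
    ∃ τ > (0 : ℝ), ∃ z, z 0 = x₀ ∧ IsLipschitzSolutionOn X F τ z := by
  obtain ⟨ρ₀, hρ₀, hcomp⟩ := exists_isCompact_inter_closedBall hX hx₀
  obtain ⟨M, hM, ρ₁, hρ₁, hbd⟩ := hF.bounded x₀ hx₀
  have hρ : 0 < min ρ₀ ρ₁ := lt_min hρ₀ hρ₁
  have hτ : 0 < min ρ₀ ρ₁ / (M + 1) := by positivity
  obtain ⟨z, hz0, hzK, hz⟩ := exists_limit_solution hF inter_subset_left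
    (hcomp _ (min_le_left ρ₀ ρ₁)) hx₀ subset_rfl (fun y hy v hv => hbd y hy.1
      ((mem_closedBall_iff_norm.1 hy.2).trans (min_le_right _ _)) v hv) hM.le hτ.le
    (mul_div_cancel₀ _ (by positivity)).le
  set τ := min ρ₀ ρ₁ / (M + 1)
  have hlip : LipschitzOnWith (M + 1).toNNReal z (Icc 0 τ) := by
    refine LipschitzOnWith.of_dist_le_mul fun r hr s hs => ?_
    rw [Real.coe_toNNReal _ (by positivity)]
    wlog hsr : s ≤ r generalizing r s
    · rw [dist_comm, dist_comm r]
      exact this s hs r hr (le_of_not_ge hsr)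
    rw [dist_eq_norm, Real.dist_eq, abs_of_nonneg (sub_nonneg.2 hsr)]
    exact (hz s r hs.1 hsr hr.2).1
  refine ⟨τ, hτ, z, hz0, ⟨_, hlip⟩, fun t ht => (hzK t ht).1, ?_⟩
  filter_upwards [hlip.ae_differentiableWithinAt_of_mem_real] with s hs hsI
  have hd : HasDerivAt z (deriv z s) s :=
    ((hs (Ioo_subset_Icc_self hsI)).differentiableAt (Icc_mem_nhds hsI.1 hsI.2)).hasDerivAt
  refine ⟨_, mem_krasovskii_of_forall_apply_le hF (hzK s (Ioo_subset_Icc_self hsI)).1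
    fun ℓ c η hη hc => ?_, hd⟩
  -- Right-hand slopes suffice, since the limit inequality runs forward in time.
  have hslope : Tendsto (slope z s) (𝓝[>] s) (𝓝 (deriv z s)) :=
    (hasDerivAt_iff_tendsto_slope.1 hd).mono_left (nhdsWithin_mono _ fun r hr => ne_of_gt hr)
  refine le_of_tendsto ((ℓ.continuous.tendsto _).comp hslope) ?_
  have hsmall : ∀ᶠ r in 𝓝[>] s, (M + 1) * (r - s) < η := by
    have : Tendsto (fun r => (M + 1) * (r - s)) (𝓝 s) (𝓝 ((M + 1) * (s - s))) :=
      (tendsto_id.sub_const s).const_mul _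
    rw [sub_self, mul_zero] at this
    exact (this.eventually_lt_const hη).filter_mono nhdsWithin_le_nhds
  filter_upwards [hsmall, Ioc_mem_nhdsGT hsI.2] with r hr hrI
  have h1 := (hz s r hsI.1.le hrI.1.le hrI.2).2 ℓ c η hr fun y hy => hc y hy.1
  rw [Function.comp_apply, slope_def_module, map_smul, smul_eq_mul,
    inv_mul_le_iff₀ (sub_pos.2 hrI.1), mul_comm]
  exact h1

/-- A Lipschitz curve whose derivative is bounded by `L` almost everywhere is `L`-Lipschitz. -/
theorem norm_sub_le_of_ae_norm_deriv_le {V : Type*} [NormedAddCommGroup V] [InnerProductSpace ℝ V]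
    {x : ℝ → V} {C : NNReal} {s r L : ℝ} (hsr : s ≤ r) (hx : LipschitzOnWith C x (Icc s r))
    (hd : ∀ᵐ t : ℝ, t ∈ Ioo s r → ∃ v, ‖v‖ ≤ L ∧ HasDerivAt x v t) :
    ‖x r - x s‖ ≤ L * (r - s) := by
  set w := x r - x s with hw
  rcases (norm_nonneg w).eq_or_lt with h0 | hpos
  · rw [← h0]
    rcases hsr.eq_or_lt with rfl | hlt
    · simp
    -- Even when `w = 0` one needs `0 ≤ L`; it comes from some time at which a derivative bounded by
    -- `L` exists.
    have hne : NeBot (ae (volume.restrict (Ioo s r))) := by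
      rw [ae_neBot, Ne, Measure.restrict_eq_zero, Real.volume_Ioo, ENNReal.ofReal_eq_zero]
      linarith
    obtain ⟨t, v, hv, -⟩ := ((ae_restrict_iff' measurableSet_Ioo).2 hd).exists
    exact mul_nonneg ((norm_nonneg v).trans hv) (sub_nonneg.2 hsr)
  -- Pairing with `w` reduces to the scalar fundamental theorem of calculus, giving `‖w‖² ≤ ‖w‖ * L
  -- * (r - s)`.
  have hac : AbsolutelyContinuousOnInterval (fun t => innerSL ℝ w (x t)) s r :=
    LipschitzOnWith.absolutelyContinuousOnInterval (K := ‖innerSL ℝ w‖₊ * C) (by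
      rw [uIcc_of_le hsr]
      exact (innerSL ℝ w).lipschitz.comp_lipschitzOnWith hx)
  have hint := hac.integral_deriv_eq_sub
  have hbd : ‖∫ t in s..r, deriv (fun t => innerSL ℝ w (x t)) t‖ ≤ ‖w‖ * L * |r - s| := by
    refine intervalIntegral.norm_integral_le_of_norm_le_const_ae ?_
    have hner : ∀ᵐ t : ℝ, t ≠ r := by simp [ae_iff]
    filter_upwards [hd, hner] with t ht htr htI
    rw [uIoc_of_le hsr] at htI
    obtain ⟨v, hv, hvd⟩ := ht ⟨htI.1, htI.2.lt_of_ne htr⟩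
    have h1 : HasDerivAt (fun t => innerSL ℝ w (x t)) (innerSL ℝ w v) t :=
      (innerSL ℝ w).hasFDerivAt.comp_hasDerivAt t hvd
    rw [h1.deriv, innerSL_apply_apply]
    exact (norm_inner_le_norm w v).trans (mul_le_mul_of_nonneg_left hv (norm_nonneg w))
  rw [hint, ← map_sub, ← hw, innerSL_apply_apply, real_inner_self_eq_norm_sq,
    Real.norm_of_nonneg (sq_nonneg _), abs_of_nonneg (sub_nonneg.2 hsr), sq, mul_assoc] at hbd
  exact le_of_mul_le_mul_left hbd hpos

namespace IsLipschitzSolutionOn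

variable {X : Set (EuclideanSpace ℝ (Fin n))}
  {F : EuclideanSpace ℝ (Fin n) → Set (EuclideanSpace ℝ (Fin n))} {a b : ℝ}
  {x z : ℝ → EuclideanSpace ℝ (Fin n)}

theorem congr (h : IsLipschitzSolutionOn X F a x) (hxz : EqOn x z (Icc 0 a)) :
    IsLipschitzSolutionOn X F a z := by
  obtain ⟨C, hC⟩ := h.lipschitz
  refine ⟨⟨C, fun s hs t ht => hxz hs ▸ hxz ht ▸ hC hs ht⟩, fun t ht => hxz ht ▸ h.mem t ht, ?_⟩
  filter_upwards [h.deriv_mem] with t ht htI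
  obtain ⟨v, hv, hd⟩ := ht htI
  refine ⟨v, hxz (Ioo_subset_Icc_self htI) ▸ hv, hd.congr_of_eventuallyEq ?_⟩
  filter_upwards [Icc_mem_nhds htI.1 htI.2] with s hs using (hxz hs).symm

theorem mono (h : IsLipschitzSolutionOn X F a x) (hba : b ≤ a) :
    IsLipschitzSolutionOn X F b x := by
  obtain ⟨C, hC⟩ := h.lipschitz
  refine ⟨⟨C, hC.mono (Icc_subset_Icc_right hba)⟩,
    fun t ht => h.mem t (Icc_subset_Icc_right hba ht), ?_⟩
  filter_upwards [h.deriv_mem] with t ht htI using ht (Ioo_subset_Ioo_right hba htI)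

/-- Concatenation of solutions. -/
theorem concat (h : IsLipschitzSolutionOn X F a x) (h' : IsLipschitzSolutionOn X F b z)
    (hxz : z 0 = x a) :
    IsLipschitzSolutionOn X F (a + b) (fun t => if t ≤ a then x t else z (t - a)) := by
  obtain ⟨C, hC⟩ := h.lipschitz
  obtain ⟨C', hC'⟩ := h'.lipschitz
  have hz : ∀ t, a ≤ t → (if t ≤ a then x t else z (t - a)) = z (t - a) := by
    intro t ht
    split_ifs with h1
    · rw [le_antisymm h1 ht, sub_self, hxz]
    · rfl
  refine ⟨⟨max C C', LipschitzOnWith.of_dist_le_mul fun r hr s hs => ?_⟩, fun t ht => ?_, ?_⟩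
  · wlog hsr : s ≤ r generalizing r s
    · rw [dist_comm, dist_comm r]
      exact this s hs r hr (le_of_not_ge hsr)
    have hle : ∀ s r, 0 ≤ s → s ≤ r → r ≤ a → dist (x r) (x s) ≤ (max C C' : NNReal) * (r - s) := by
      intro s r hs hsr hr
      have h1 := hC.dist_le_mul r ⟨hs.trans hsr, hr⟩ s ⟨hs, hsr.trans hr⟩
      rw [Real.dist_eq, abs_of_nonneg (sub_nonneg.2 hsr)] at h1
      exact h1.trans (mul_le_mul_of_nonneg_right (NNReal.coe_le_coe.2 (le_max_left _ _))
        (sub_nonneg.2 hsr))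
    have hge : ∀ s r, a ≤ s → s ≤ r → r ≤ a + b →
        dist (z (r - a)) (z (s - a)) ≤ (max C C' : NNReal) * (r - s) := by
      intro s r hs hsr hr
      have h1 := hC'.dist_le_mul (r - a) ⟨by linarith, by linarith⟩ (s - a)
        ⟨by linarith, by linarith⟩
      rw [Real.dist_eq, sub_sub_sub_cancel_right, abs_of_nonneg (sub_nonneg.2 hsr)] at h1
      exact h1.trans (mul_le_mul_of_nonneg_right (NNReal.coe_le_coe.2 (le_max_right _ _))
        (sub_nonneg.2 hsr))
    rw [Real.dist_eq, abs_of_nonneg (sub_nonneg.2 hsr)]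
    rcases le_total r a with hra | hra
    · simp only [if_pos hra, if_pos (hsr.trans hra)]
      exact hle s r hs.1 hsr hra
    rcases le_total s a with hsa | hsa
    · simp only [hz r hra, if_pos hsa]
      have h1 := hle s a hs.1 hsa le_rfl
      have h2 := hge a r le_rfl hra hr.2
      rw [sub_self, hxz] at h2
      have h3 := dist_triangle (z (r - a)) (x a) (x s)
      linarith
    · simp only [hz r hra, hz s hsa]
      exact hge s r hsa hsr hr.2
  · split_ifs with hta
    · exact h.mem t ⟨ht.1, hta⟩
    · exact h'.mem _ ⟨by linarith, by linarith [ht.2]⟩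
  · have hne : ∀ᵐ t : ℝ, t ≠ a := by simp [ae_iff]
    have hshift := (measurePreserving_sub_right (volume : Measure ℝ) a).quasiMeasurePreserving.ae
      h'.deriv_mem
    filter_upwards [h.deriv_mem, hne, hshift] with t ht1 hta ht2 htI
    rcases lt_or_gt_of_ne hta with hlt | hlt
    · obtain ⟨v, hv, hd⟩ := ht1 ⟨htI.1, hlt⟩
      refine ⟨v, by rwa [if_pos hlt.le], hd.congr_of_eventuallyEq ?_⟩
      filter_upwards [Iio_mem_nhds hlt] with s hs using if_pos (le_of_lt hs)
    · obtain ⟨v, hv, hd⟩ := ht2 ⟨by linarith, by linarith [htI.2]⟩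
      refine ⟨v, by rwa [hz t hlt.le], (hd.comp_sub_const t a).congr_of_eventuallyEq ?_⟩
      filter_upwards [Ioi_mem_nhds hlt] with s hs using hz s (le_of_lt hs)

end IsLipschitzSolutionOn

/-! ### Continuation and maximal solutions -/

/-- A Krasovskii solution on `[0, T)` that is Lipschitz on every compact subinterval. -/
structure IsLocallyLipschitzSolution (X : Set (EuclideanSpace ℝ (Fin n)))
    (F : EuclideanSpace ℝ (Fin n) → Set (EuclideanSpace ℝ (Fin n)))
    (x₀ : EuclideanSpace ℝ (Fin n)) (T : EReal) (x : ℝ → EuclideanSpace ℝ (Fin n)) : Prop where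
  pos : 0 < T
  init : x 0 = x₀
  sol : ∀ a : ℝ, (a : EReal) < T → IsLipschitzSolutionOn X F a x

namespace IsLocallyLipschitzSolution

variable {X : Set (EuclideanSpace ℝ (Fin n))}
  {F : EuclideanSpace ℝ (Fin n) → Set (EuclideanSpace ℝ (Fin n))}
  {x₀ : EuclideanSpace ℝ (Fin n)} {T : EReal} {x : ℝ → EuclideanSpace ℝ (Fin n)}

theorem deriv_mem (h : IsLocallyLipschitzSolution X F x₀ T x) :
    ∀ᵐ t : ℝ, t ∈ timeInterval T → ∃ v ∈ krasovskii X F (x t), HasDerivAt x v t := by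
  -- Rational endpoints keep the union of exceptional null sets countable.
  have hq : ∀ᵐ t : ℝ, ∀ q : ℚ, ((q : ℝ) : EReal) < T → t ∈ Ioo (0 : ℝ) q →
      ∃ v ∈ krasovskii X F (x t), HasDerivAt x v t := by
    refine ae_all_iff.2 fun q => ?_
    by_cases hqT : ((q : ℝ) : EReal) < T
    · filter_upwards [(h.sol q hqT).deriv_mem] with t ht _ using ht
    · exact Eventually.of_forall fun t h => (hqT h).elim
  have hne : ∀ᵐ t : ℝ, t ≠ 0 := by simp [ae_iff]
  filter_upwards [hq, hne] with t ht ht0 htT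
  obtain ⟨q, htq, hqT⟩ := EReal.lt_iff_exists_rat_btwn.1 htT.2
  exact ht q hqT ⟨htT.1.lt_of_ne' ht0, EReal.coe_lt_coe_iff.1 htq⟩

theorem isKrasovskiiSolution (h : IsLocallyLipschitzSolution X F x₀ T x) :
    IsKrasovskiiSolution X F x₀ T x where
  pos := h.pos
  init := h.init
  mem t ht := (h.sol t ht.2).mem t ⟨ht.1, le_rfl⟩
  absCont t ht := by
    obtain ⟨C, hC⟩ := (h.sol t ht.2).lipschitz
    exact LipschitzOnWith.absolutelyContinuousOnInterval (by rwa [uIcc_of_le ht.1])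
  deriv_mem := h.deriv_mem

theorem locallyLipschitzOn (h : IsLocallyLipschitzSolution X F x₀ T x) :
    LocallyLipschitzOn (timeInterval T) x := by
  intro t ht
  obtain ⟨a, hta, haT⟩ := EReal.lt_iff_exists_real_btwn.1 ht.2
  obtain ⟨C, hC⟩ := (h.sol a haT).lipschitz
  refine ⟨C, Icc 0 a, ?_, hC⟩
  filter_upwards [self_mem_nhdsWithin,
    mem_nhdsWithin_of_mem_nhds (Iio_mem_nhds (EReal.coe_lt_coe_iff.1 hta))] with s hs hsa
  exact ⟨hs.1, le_of_lt hsa⟩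

/-- A solution that is Lipschitz on `[0, T)`, `T < ∞`, and whose closure stays in `X` can be
continued beyond `T`. -/
theorem exists_continuation (hX : IsLocallyClosed X) (hF : IsLocallyBoundedTangentField X F)
    {T : ℝ} (h : IsLocallyLipschitzSolution X F x₀ T x) {C : NNReal}
    (hC : LipschitzOnWith C x (Ico 0 T)) (hcl : closure (x '' Ico 0 T) ⊆ X) :
    ∃ T' > T, ∃ z, IsLocallyLipschitzSolution X F x₀ (T' : ℝ) z ∧ EqOn x z (Ico 0 T) := by
  have hT : 0 < T := EReal.coe_pos.1 h.pos
  -- A global Lipschitz extension supplies the endpoint value as `y T`.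
  obtain ⟨y, hy, hxy⟩ := hC.extend_finite_dimension
  have hyT : y T ∈ X := by
    refine hcl (map_mem_closure hy.continuous (s := Ico 0 T) ?_ fun t ht => ?_)
    · rw [closure_Ico hT.ne]
      exact ⟨hT.le, le_rfl⟩
    · rw [← hxy ht]
      exact mem_image_of_mem x ht
  obtain ⟨τ, hτ, z, hz0, hz⟩ := exists_isLipschitzSolutionOn hX hF hyT
  have hys : IsLipschitzSolutionOn X F T y := by
    refine ⟨⟨_, hy.lipschitzOnWith⟩, fun t ht => ?_, ?_⟩
    · rcases ht.2.eq_or_lt with rfl | htT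
      · exact hyT
      · rw [← hxy ⟨ht.1, htT⟩]
        exact (h.sol t (EReal.coe_lt_coe_iff.2 htT)).mem t ⟨ht.1, le_rfl⟩
    · filter_upwards [h.deriv_mem] with t ht htI
      obtain ⟨v, hv, hd⟩ := ht ⟨htI.1.le, EReal.coe_lt_coe_iff.2 htI.2⟩
      refine ⟨v, by rwa [← hxy (Ioo_subset_Ico_self htI)], hd.congr_of_eventuallyEq ?_⟩
      filter_upwards [Ico_mem_nhds htI.1 htI.2] with s hs using (hxy hs).symm
  refine ⟨T + τ, lt_add_of_pos_right T hτ, _, ⟨EReal.coe_pos.2 (by positivity), ?_, fun a ha =>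
    (hys.concat hz hz0).mono (EReal.coe_lt_coe_iff.1 ha).le⟩, fun t ht => ?_⟩
  · rw [if_pos hT.le, ← hxy ⟨le_rfl, hT⟩, h.init]
  · rw [hxy ht]
    exact (if_pos ht.2.le).symm

/-- Every chain of solutions ordered by continuation has an upper bound. -/
theorem exists_upper_bound {c : Set (EReal × (ℝ → EuclideanSpace ℝ (Fin n)))}
    (hc : ∀ p ∈ c, IsLocallyLipschitzSolution X F x₀ p.1 p.2) (hne : c.Nonempty)
    (hchain : IsChain (fun p q => p.1 ≤ q.1 ∧ EqOn p.2 q.2 (timeInterval p.1)) c) :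
    ∃ T x, IsLocallyLipschitzSolution X F x₀ T x ∧
      ∀ p ∈ c, p.1 ≤ T ∧ EqOn p.2 x (timeInterval p.1) := by
  have hex : ∀ t : ℝ, ∃ w, ∀ p ∈ c, t ∈ timeInterval p.1 → p.2 t = w := by
    intro t
    by_cases ht : ∃ p ∈ c, t ∈ timeInterval p.1
    · obtain ⟨q, hq, htq⟩ := ht
      refine ⟨q.2 t, fun p hp htp => ?_⟩
      rcases eq_or_ne p q with rfl | hpq
      · rfl
      rcases hchain hp hq hpq with h | h
      · exact h.2 htp
      · exact (h.2 htq).symm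
    · exact ⟨0, fun p hp htp => (ht ⟨p, hp, htp⟩).elim⟩
  choose x hx using hex
  have hle : ∀ p ∈ c, p.1 ≤ sSup (Prod.fst '' c) := fun p hp => le_sSup (mem_image_of_mem _ hp)
  refine ⟨sSup (Prod.fst '' c), x, ⟨?_, ?_, fun a ha => ?_⟩,
    fun p hp => ⟨hle p hp, fun t ht => hx t p hp ht⟩⟩
  · obtain ⟨p, hp⟩ := hne
    exact (hc p hp).pos.trans_le (hle p hp)
  · obtain ⟨p, hp⟩ := hne
    rw [← hx 0 p hp ⟨le_rfl, (hc p hp).pos⟩, (hc p hp).init]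
  · obtain ⟨_, ⟨p, hp, rfl⟩, hap⟩ := lt_sSup_iff.1 ha
    exact ((hc p hp).sol a hap).congr fun t ht =>
      hx t p hp ⟨ht.1, (EReal.coe_le_coe_iff.2 ht.2).trans_lt hap⟩

/-- Existence of a maximal solution. -/
theorem exists_maximal (hX : IsLocallyClosed X) (hF : IsLocallyBoundedTangentField X F)
    (hx₀ : x₀ ∈ X) :
    ∃ T x, IsLocallyLipschitzSolution X F x₀ T x ∧
      ∀ T' z, IsLocallyLipschitzSolution X F x₀ T' z → T ≤ T' → EqOn x z (timeInterval T) →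
        T' ≤ T := by
  obtain ⟨τ, hτ, z, hz0, hz⟩ := exists_isLipschitzSolutionOn hX hF hx₀
  have hzs : IsLocallyLipschitzSolution X F x₀ τ z :=
    ⟨EReal.coe_pos.2 hτ, hz0, fun a ha => hz.mono (EReal.coe_lt_coe_iff.1 ha).le⟩
  -- Continuation is only a preorder, as values outside the time interval are arbitrary; so
  -- maximality is stated for lifetimes.
  obtain ⟨⟨m, hm⟩, hmax⟩ := exists_maximal_of_chains_bounded
    (α := {p : EReal × (ℝ → EuclideanSpace ℝ (Fin n)) //
      IsLocallyLipschitzSolution X F x₀ p.1 p.2})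
    (r := fun p q => p.1.1 ≤ q.1.1 ∧ EqOn p.1.2 q.1.2 (timeInterval p.1.1))
    (fun c hc => by
      rcases c.eq_empty_or_nonempty with rfl | hne
      · exact ⟨⟨(τ, z), hzs⟩, fun a ha => ha.elim⟩
      obtain ⟨T, x, hTx, hub⟩ := exists_upper_bound (c := Subtype.val '' c)
        (by rintro _ ⟨p, -, rfl⟩; exact p.2) (hne.image _)
        (by
          rintro _ ⟨p, hp, rfl⟩ _ ⟨q, hq, rfl⟩ hpq
          exact hc hp hq fun h => hpq (congrArg _ h))
      exact ⟨⟨(T, x), hTx⟩, fun p hp => hub p (mem_image_of_mem _ hp)⟩)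
    (fun {p q r} hpq hqr => ⟨hpq.1.trans hqr.1, fun t ht =>
      (hpq.2 ht).trans (hqr.2 ⟨ht.1, ht.2.trans_le hpq.1⟩)⟩)
  exact ⟨m.1, m.2, hm, fun T' z hz hle heq => (hmax ⟨(T', z), hz⟩ ⟨hle, heq⟩).1⟩

/-! ### The lower bound on the lifetime -/

/-- A solution does not leave a ball of radius `r` before time `r / L` if velocities in the ball are
bounded by `L`. -/
theorem norm_sub_le (h : IsLocallyLipschitzSolution X F x₀ T x) {r L : ℝ} (hL : 0 < L)
    (hTr : T ≤ (r / L : ℝ))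
    (hv : ∀ y ∈ X, ‖y - x₀‖ ≤ r → ∀ v ∈ krasovskii X F y, ‖v‖ ≤ L) :
    ∀ t ∈ timeInterval T, ‖x t - x₀‖ ≤ r := by
  intro t ht
  by_contra! hlt
  obtain ⟨C, hC⟩ := (h.sol t ht.2).lipschitz
  have hcomp : IsCompact (Icc 0 t ∩ {s | r ≤ ‖x s - x₀‖}) := by
    refine isCompact_Icc.of_isClosed_subset ?_ inter_subset_left
    exact (hC.continuousOn.sub continuousOn_const).norm.preimage_isClosed_of_isClosed
      isClosed_Icc isClosed_Ici
  -- At the first time `σ` with distance at least `r`, all earlier velocities are bounded by `L`, so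
  -- `r ≤ L * σ`, against `σ < T ≤ r / L`.
  obtain ⟨σ, ⟨hσI, hσ⟩, hmin⟩ := hcomp.exists_isLeast ⟨t, ⟨ht.1, le_rfl⟩, hlt.le⟩
  have hσT : (σ : EReal) < T := (EReal.coe_le_coe_iff.2 hσI.2).trans_lt ht.2
  have hsol := h.sol σ hσT
  have hb : ‖x σ - x 0‖ ≤ L * (σ - 0) := by
    refine norm_sub_le_of_ae_norm_deriv_le hσI.1 (hC.mono (Icc_subset_Icc_right hσI.2)) ?_
    filter_upwards [hsol.deriv_mem] with s hs hsI
    obtain ⟨v, hvK, hd⟩ := hs hsI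
    refine ⟨v, hv _ (hsol.mem s (Ioo_subset_Icc_self hsI)) ?_ v hvK, hd⟩
    by_contra! hsr
    exact hsI.2.not_ge (hmin ⟨⟨hsI.1.le, hsI.2.le.trans hσI.2⟩, hsr.le⟩)
  have hlt' : σ < r / L := EReal.coe_lt_coe_iff.1 (hσT.trans_le hTr)
  rw [lt_div_iff₀ hL, mul_comm] at hlt'
  rw [h.init, sub_zero] at hb
  exact hlt'.not_ge (le_trans hσ hb)

/-- A maximal solution exists longer than `r / L`. -/
theorem lt_of_maximal (hX : IsLocallyClosed X) (hF : IsLocallyBoundedTangentField X F)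
    (h : IsLocallyLipschitzSolution X F x₀ T x)
    (hmax : ∀ T' z, IsLocallyLipschitzSolution X F x₀ T' z → T ≤ T' →
      EqOn x z (timeInterval T) → T' ≤ T)
    {r L : ℝ} (hL : 0 < L) (hcl : IsClosed {y | y ∈ X ∧ ‖y - x₀‖ ≤ r})
    (hv : ∀ y ∈ X, ‖y - x₀‖ ≤ r → ∀ v ∈ krasovskii X F y, ‖v‖ ≤ L) :
    ((r / L : ℝ) : EReal) < T := by
  by_contra! hTr
  have hball := h.norm_sub_le hL hTr hv
  lift T to ℝ using ⟨(hTr.trans_lt (EReal.coe_lt_top _)).ne, h.pos.bot_lt.ne'⟩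
  have hIco : ∀ t ∈ Ico 0 T, t ∈ timeInterval T := fun t ht => ⟨ht.1, EReal.coe_lt_coe_iff.2 ht.2⟩
  have hmem : ∀ t ∈ Ico 0 T, x t ∈ X := fun t ht => h.isKrasovskiiSolution.mem t (hIco t ht)
  have hlip : LipschitzOnWith L.toNNReal x (Ico 0 T) := by
    refine LipschitzOnWith.of_dist_le_mul fun t ht s hs => ?_
    wlog hst : s ≤ t generalizing t s
    · rw [dist_comm, dist_comm t]
      exact this s hs t ht (le_of_not_ge hst)
    obtain ⟨C, hC⟩ := (h.sol t (EReal.coe_lt_coe_iff.2 ht.2)).lipschitz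
    rw [Real.coe_toNNReal _ hL.le, dist_eq_norm, Real.dist_eq, abs_of_nonneg (sub_nonneg.2 hst)]
    refine norm_sub_le_of_ae_norm_deriv_le hst (hC.mono (Icc_subset_Icc_left hs.1)) ?_
    filter_upwards [h.deriv_mem] with q hq hqI
    have hqI' : q ∈ Ico 0 T := ⟨hs.1.trans hqI.1.le, hqI.2.trans ht.2⟩
    obtain ⟨v, hvK, hd⟩ := hq (hIco q hqI')
    exact ⟨v, hv _ (hmem q hqI') (hball q (hIco q hqI')) v hvK, hd⟩
  have hsub : closure (x '' Ico 0 T) ⊆ {y | y ∈ X ∧ ‖y - x₀‖ ≤ r} :=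
    closure_minimal (image_subset_iff.2 fun t ht => ⟨hmem t ht, hball t (hIco t ht)⟩) hcl
  obtain ⟨T', hT', z, hz, hxz⟩ := h.exists_continuation hX hF hlip fun y hy => (hsub hy).1
  exact (EReal.coe_lt_coe_iff.2 hT').not_ge (hmax _ z hz (EReal.coe_lt_coe_iff.2 hT').le
    fun t ht => hxz ⟨ht.1, EReal.coe_lt_coe_iff.1 ht.2⟩)

end IsLocallyLipschitzSolution

end ProjDyn

theorem mainTheorem1 {n : ℕ} (X : Set (EuclideanSpace ℝ (Fin n))) (hX : IsLocallyClosed X)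
    (f : EuclideanSpace ℝ (Fin n) → EuclideanSpace ℝ (Fin n))
    (hf : ProjDyn.LocallyBoundedOn X f)
    (g : EuclideanSpace ℝ (Fin n) → LinearMap.BilinForm ℝ (EuclideanSpace ℝ (Fin n)))
    (hg : ProjDyn.IsMetricOn X g) (hgb : ProjDyn.LocallyWeaklyBoundedOn X g)
    (x₀ : EuclideanSpace ℝ (Fin n)) (hx₀ : x₀ ∈ X) :
    ∃ (T : EReal) (x : ℝ → EuclideanSpace ℝ (Fin n)),
      ProjDyn.IsKrasovskiiSolution X (ProjDyn.projectedField X g f) x₀ T x ∧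
      LocallyLipschitzOn (ProjDyn.timeInterval T) x ∧
      ∀ r > (0 : ℝ), ∀ L > (0 : ℝ),
        IsClosed {y | y ∈ X ∧ ‖y - x₀‖ ≤ r} →
        (∀ y ∈ X, ‖y - x₀‖ ≤ r →
          ∀ v ∈ ProjDyn.krasovskii X (ProjDyn.projectedField X g f) y, ‖v‖ ≤ L) →
        ((r / L : ℝ) : EReal) < T := by
  have hF := ProjDyn.isLocallyBoundedTangentField_projectedField hf hgb
  obtain ⟨T, x, hx, hmax⟩ := ProjDyn.IsLocallyLipschitzSolution.exists_maximal hX hF hx₀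
  exact ⟨T, x, hx.isKrasovskiiSolution, hx.locallyLipschitzOn,
    fun r _ L hL hcl hv => hx.lt_of_maximal hX hF hmax hL hcl hv⟩
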